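/- Let $\mathsf A$ be an arbitrary (not necessarily unital) $C^*$-algebra and $X$ a right Hilbert $\mathsf A$-module, with inner product $\langle\cdot,\cdot\rangle$ linear in the second variable. Let $\ell^2(\mathsf A)$ be the inner product $\mathsf A$-module of all sequences $(a_n)_{n\in\mathbb N}$ in $\mathsf A$ for which $\sum_n a_n^*a_n$ converges in norm, with $\langle (a_n)_n,(b_n)_n\rangle=\sum_n a_n^*b_n$. Let $\mathbb B(X,Y)$ be the set of adjointable operators from $X$ to $Y$, $\mathbb B(X)=\mathbb B(X,X)$, and let $M(X)=\mathbb B(\mathsf A,X)$ be the multiplier module of $X$; it contains $X$ ($x\in X$ is identified with the operator $a\mapsto xa$). For $v\in M(X)$, $x\in X$ and $a\in\mathsf A$ put $\langle v,x\rangle=v^*x\in\mathsf A$, $\langle x,v\rangle=\langle v,x\rangle^*$ and $va=v(a)\in X$, and for $S\in\mathbb B(X)$ write $Sv=S\circ v\in M(X)$. A sequence $(v_n)_{n\in\mathbb N}$ in $X$ is a frame for $X$ if there are constants $C,D>0$ such that $$C\langle x,x\rangle\le\sum_{n}\langle x,v_n\rangle\langle v_n,x\rangle\le D\langle x,x\rangle\qquad\text{for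 all }x\in X,$$ where the series converges in norm. A sequence in $M(X)$ with the same property, at least one of whose members is not in $X$, is an outer frame for $X$. An operator $U\in\mathbb B(X,\ell^2(\mathsf A))$ is the analysis operator of $(v_n)_n$ if $Ux=(\langle v_n,x\rangle)_n$ for all $x\in X$. A frame or outer frame $(w_n)_n$ for $X$ is dual to the frame or outer frame $(v_n)_n$ if $\sum_n w_n\langle v_n,x\rangle=x$ for all $x\in X$, the series converging in norm. **Theorem.** Let $(x_n)_n$ be a frame or an outer frame for $X$. Then its analysis operator $U\in\mathbb B(X,\ell^2(\mathsf A))$ exists, $U^*U$ is invertible in $\mathbb B(X)$, and: 1. An operator $V\in\mathbb B(X,\ell^2(\mathsf A))$ is the analysis operator of a frame or an outer frame dual to $(x_n)_n$ if and only if $$V=U(U^*U)^{-1}+\bigl(I-U(U^*U)^{-1}U^*\bigr)L\qquad\text{for some }L\in\mathbb B(X,\ell^2(\mathsf A)).$$ 2. The canonical dual $((U^*U)^{-1}x_n)_n$ is a frame or an outer frame dual to $(x_n)_n$, and its frame coefficients are minimal: for every frame or outer frame $(y_n)_n$ dual to $(x_n)_n$, $$\sum_n\langle x,(U^*U)^{-1}x_n\rangle\langle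 (U^*U)^{-1}x_n,x\rangle\le\sum_n\langle x,y_n\rangle\langle y_n,x\rangle\qquad\text{for all }x\in X,$$ where both series converge in norm. -/

import Mathlib

open Filter Topology

/-- `∑_{n ≥ 0} f n = s`: the partial sums of the series converge to `s`. -/
def SeriesTo {E : Type*} [AddCommMonoid E] [TopologicalSpace E] (f : ℕ → E) (s : E) : Prop :=
  Tendsto (fun N => ∑ n ∈ Finset.range N, f n) atTop (𝓝 s)

/-- The structure of a right inner product `A`-module over a (not necessarily unital) C⋆-algebra
`A`; the right action `x ↦ x a` is written `MulOpposite.op a • x`. The norm is the one induced by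
the inner product, so that a *Hilbert `A`-module* is such an `X` which is complete. The
module axioms for the action of `A` and its compatibility with `ℂ` follow from the listed ones.
(Mathlib's `CStarModule` is the left-handed version of this class.) -/
class HilbertModule (A X : Type*) [NonUnitalCStarAlgebra A] [PartialOrder A]
    [AddCommGroup X] [Module ℂ X] [SMul Aᵐᵒᵖ X] [Norm X] where
  ip : X → X → A
  ip_add_right : ∀ x y z : X, ip x (y + z) = ip x y + ip x z
  ip_smul_right : ∀ (c : ℂ) (x y : X), ip x (c • y) = c • ip x y
  ip_op_smul_right : ∀ (a : A) (x y : X), ip x (MulOpposite.op a • y) = ip x y * a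
  star_ip : ∀ x y : X, star (ip x y) = ip y x
  ip_self_nonneg : ∀ x : X, 0 ≤ ip x x
  ip_self : ∀ x : X, ip x x = 0 ↔ x = 0
  norm_eq : ∀ x : X, ‖x‖ = √‖ip x x‖

namespace HilbertModule

section Basic

variable {A X : Type*} [NonUnitalCStarAlgebra A] [PartialOrder A]
  [AddCommGroup X] [Module ℂ X] [SMul Aᵐᵒᵖ X] [Norm X] [HilbertModule A X]

theorem ip_add_left (x y z : X) : (ip (x + y) z : A) = ip x z + ip y z := by
  rw [← star_ip, ip_add_right, star_add, star_ip, star_ip]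

theorem ip_smul_left (c : ℂ) (x y : X) : (ip (c • x) y : A) = star c • ip x y := by
  rw [← star_ip, ip_smul_right, star_smul, star_ip]

theorem ip_neg_right (x y : X) : (ip x (-y) : A) = -ip x y := by
  rw [← neg_one_smul ℂ y, ip_smul_right, neg_one_smul]

theorem ip_neg_left (x y : X) : (ip (-x) y : A) = -ip x y := by
  rw [← star_ip, ip_neg_right, star_neg, star_ip]

theorem ip_sub_right (x y z : X) : (ip x (y - z) : A) = ip x y - ip x z := by
  rw [sub_eq_add_neg, ip_add_right, ip_neg_right, sub_eq_add_neg]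

theorem ip_sub_left (x y z : X) : (ip (x - y) z : A) = ip x z - ip y z := by
  rw [sub_eq_add_neg, ip_add_left, ip_neg_left, sub_eq_add_neg]

variable (A) in
/-- The inner product separates points. -/
theorem ext_ip {x y : X} (h : ∀ z : X, (ip z x : A) = ip z y) : x = y := by
  have h1 : (ip (x - y) (x - y) : A) = 0 := by rw [ip_sub_right, h, sub_self]
  exact sub_eq_zero.mp ((ip_self _).mp h1)

end Basic

/-- `A` as a Hilbert module over itself: `⟨a, b⟩ = a⋆ b`, with right multiplication as action. -/
instance instSelf (A : Type*) [NonUnitalCStarAlgebra A] [PartialOrder A] [StarOrderedRing A] :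
    HilbertModule A A where
  ip a b := star a * b
  ip_add_right a b c := mul_add _ _ _
  ip_smul_right c a b := mul_smul_comm _ _ _
  ip_op_smul_right a b c := by rw [op_smul_eq_mul, mul_assoc]
  star_ip a b := by simp
  ip_self_nonneg a := star_mul_self_nonneg a
  ip_self a := CStarRing.star_mul_self_eq_zero_iff a
  norm_eq a := by rw [CStarRing.norm_star_mul_self, Real.sqrt_mul_self (norm_nonneg a)]

end HilbertModule

/-- `𝔹(X, Y)`: adjointable operators `T : X → Y`, i.e. maps for which there is `T⋆ : Y → X` with
`⟨T x, y⟩ = ⟨x, T⋆ y⟩` for all `x`, `y`. The adjoint is unique, so that `T` is determined by its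
values (`Adjointable.ext`); linearity over `ℂ` and `A` and, on Hilbert modules, boundedness are
automatic. -/
structure Adjointable (A X Y : Type*) [NonUnitalCStarAlgebra A] [PartialOrder A]
    [AddCommGroup X] [Module ℂ X] [SMul Aᵐᵒᵖ X] [Norm X] [HilbertModule A X]
    [AddCommGroup Y] [Module ℂ Y] [SMul Aᵐᵒᵖ Y] [Norm Y] [HilbertModule A Y] where
  toFun : X → Y
  adjFun : Y → X
  ip_adj : ∀ (x : X) (y : Y),
    (HilbertModule.ip (toFun x) y : A) = HilbertModule.ip x (adjFun y)

namespace Adjointable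

open HilbertModule

variable {A X Y Z : Type*} [NonUnitalCStarAlgebra A] [PartialOrder A]
  [AddCommGroup X] [Module ℂ X] [SMul Aᵐᵒᵖ X] [Norm X] [HilbertModule A X]
  [AddCommGroup Y] [Module ℂ Y] [SMul Aᵐᵒᵖ Y] [Norm Y] [HilbertModule A Y]
  [AddCommGroup Z] [Module ℂ Z] [SMul Aᵐᵒᵖ Z] [Norm Z] [HilbertModule A Z]

instance : CoeFun (Adjointable A X Y) (fun _ => X → Y) := ⟨toFun⟩

@[ext]
theorem ext {S T : Adjointable A X Y} (h : ∀ x, S x = T x) : S = T := by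
  have h2 : ∀ y, S.adjFun y = T.adjFun y := fun y =>
    ext_ip A fun x => by rw [← S.ip_adj, ← T.ip_adj, h]
  cases S
  cases T
  congr
  · exact funext h
  · exact funext h2

/-- The adjoint `T⋆`. -/
def adjoint (T : Adjointable A X Y) : Adjointable A Y X where
  toFun := T.adjFun
  adjFun := T.toFun
  ip_adj y x := by rw [← star_ip, ← T.ip_adj, star_ip]

/-- The composition `S ∘ T`. -/
def comp (S : Adjointable A Y Z) (T : Adjointable A X Y) : Adjointable A X Z where
  toFun x := S (T x)
  adjFun z := T.adjFun (S.adjFun z)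
  ip_adj x z := by rw [S.ip_adj, T.ip_adj]

variable (A X) in
/-- The identity operator `I`. -/
def id : Adjointable A X X where
  toFun x := x
  adjFun x := x
  ip_adj _ _ := rfl

instance : Add (Adjointable A X Y) where
  add S T :=
    { toFun := fun x => S x + T x
      adjFun := fun y => S.adjFun y + T.adjFun y
      ip_adj := fun x y => by rw [ip_add_left, ip_add_right, S.ip_adj, T.ip_adj] }

instance : Sub (Adjointable A X Y) where
  sub S T :=
    { toFun := fun x => S x - T x
      adjFun := fun y => S.adjFun y - T.adjFun y
      ip_adj := fun x y => by rw [ip_sub_left, ip_sub_right, S.ip_adj, T.ip_adj] }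

end Adjointable

/-! ### The generalized Hilbert space `ℓ²(A)` -/

section EllTwo

variable (A : Type*) [NonUnitalCStarAlgebra A] [PartialOrder A] [StarOrderedRing A]

variable {A} in
/-- A series of positive elements which is dominated by a summable one is summable. -/
theorem summable_of_nonneg_of_le' {f g : ℕ → A} (hf : ∀ n, 0 ≤ f n) (hfg : ∀ n, f n ≤ g n)
    (hg : Summable g) : Summable f := by
  rw [summable_iff_vanishing_norm] at hg ⊢
  intro ε hε
  obtain ⟨s, hs⟩ := hg ε hε
  refine ⟨s, fun t ht => lt_of_le_of_lt ?_ (hs t ht)⟩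
  exact CStarAlgebra.norm_le_norm_of_nonneg_of_le (Finset.sum_nonneg fun n _ => hf n)
    (Finset.sum_le_sum fun n _ => hfg n)

variable {A} in
/-- A series of positive elements is (unconditionally) summable as soon as its partial sums
converge in norm. -/
theorem summable_iff_exists_seriesTo {f : ℕ → A} (hf : ∀ n, 0 ≤ f n) :
    Summable f ↔ ∃ s, SeriesTo f s := by
  refine ⟨fun h => ⟨_, h.hasSum.tendsto_sum_nat⟩, fun ⟨s, hs⟩ => ?_⟩
  rw [summable_iff_vanishing_norm]
  intro ε hε
  obtain ⟨N, hN⟩ := Metric.cauchySeq_iff'.mp hs.cauchySeq ε hε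
  refine ⟨Finset.range N, fun t ht => ?_⟩
  obtain ⟨M, hM⟩ : ∃ M, t ⊆ Finset.range M := t.exists_nat_subset_range
  have hsub : t ⊆ Finset.range (max M N) \ Finset.range N := fun i hi => by
    have h1 := Finset.mem_range.mp (hM hi)
    have h2 := Finset.disjoint_left.mp ht hi
    simp only [Finset.mem_sdiff, Finset.mem_range] at h2 ⊢
    omega
  refine lt_of_le_of_lt (CStarAlgebra.norm_le_norm_of_nonneg_of_le
    (Finset.sum_nonneg fun n _ => hf n)
    (Finset.sum_le_sum_of_subset_of_nonneg hsub fun n _ _ => hf n)) ?_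
  have h3 := hN (max M N) (le_max_right _ _)
  rwa [dist_eq_norm, ← Finset.sum_sdiff (Finset.range_mono (le_max_right M N)),
    add_sub_cancel_right] at h3

variable {A} in
theorem summable_star_mul_self_add {a b : ℕ → A} (ha : Summable fun n => star (a n) * a n)
    (hb : Summable fun n => star (b n) * b n) :
    Summable fun n => star (a n + b n) * (a n + b n) := by
  have key : ∀ x y : A, star (x + y) * (x + y)
      ≤ (star x * x + star y * y) + (star x * x + star y * y) := fun x y => by
    have h := star_mul_self_nonneg (x - y)
    have h2 : (star x * x + star y * y) + (star x * x + star y * y)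
        = star (x + y) * (x + y) + star (x - y) * (x - y) := by
      simp only [star_add, star_sub, add_mul, mul_add, sub_mul, mul_sub]
      abel
    rw [h2]
    exact le_add_of_nonneg_right h
  exact summable_of_nonneg_of_le' (fun n => star_mul_self_nonneg _) (fun n => key _ _)
    ((ha.add hb).add (ha.add hb))

/-- The square summable sequences: `∑ aₙ⋆ aₙ` converges in norm. (For a series of positive
elements, convergence of the partial sums and unconditional summability are the same, see
`summable_iff_exists_seriesTo`.) -/
def ellTwoSubmodule : Submodule ℂ (ℕ → A) where
  carrier := {a | Summable fun n => star (a n) * a n}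
  add_mem' ha hb := summable_star_mul_self_add ha hb
  zero_mem' := by simp
  smul_mem' c a ha := by
    have h : Summable fun n => (star c * c) • (star (a n) * a n) := Summable.const_smul _ ha
    refine h.congr fun n => ?_
    simp [smul_mul_smul_comm]

/-- The generalized Hilbert space `ℓ²(A)`. -/
def EllTwo : Type _ := ↥(ellTwoSubmodule A)

namespace EllTwo

noncomputable instance : AddCommGroup (EllTwo A) :=
  inferInstanceAs (AddCommGroup ↥(ellTwoSubmodule A))

noncomputable instance : Module ℂ (EllTwo A) :=
  inferInstanceAs (Module ℂ ↥(ellTwoSubmodule A))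

/-- `a n` is the `n`-th term of `a ∈ ℓ²(A)`. -/
instance : CoeFun (EllTwo A) (fun _ => ℕ → A) := ⟨fun a => a.1⟩

variable {A}

/-- `⟨a, b⟩ = ∑ aₙ⋆ bₙ`; the series converges by `EllTwo.summable_star_mul`. -/
noncomputable def ip (a b : EllTwo A) : A := ∑' n, star (a n) * b n

/-- The series defining the inner product converges. -/
theorem summable_star_mul (a b : EllTwo A) : Summable fun n => star (a n) * b n := by
  have h : ∀ c : ℂ, Summable fun n => star (a n + c • b n) * (a n + c • b n) := fun c =>
    summable_star_mul_self_add a.2 ((ellTwoSubmodule A).smul_mem c b.2)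
  have h4 := ((((h 1).sub (h (-1))).sub ((h Complex.I).const_smul Complex.I)).add
    ((h (-Complex.I)).const_smul Complex.I)).const_smul (4⁻¹ : ℂ)
  refine h4.congr fun n => ?_
  simp only [star_add, star_smul, add_mul, mul_add, smul_mul_assoc, mul_smul_comm, smul_smul,
    smul_add]
  simp only [one_smul, star_neg, star_one, Complex.star_def, Complex.conj_I]
  match_scalars <;> ring_nf <;> simp [Complex.I_sq]
  all_goals ring_nf

instance : SMul Aᵐᵒᵖ (EllTwo A) where
  smul c a := ⟨fun n => a n * c.unop, by
    have h : Summable fun n => star c.unop * (star (a n) * a n) * c.unop :=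
      (Summable.mul_left _ a.2).mul_right _
    exact h.congr fun n => by simp [mul_assoc]⟩

noncomputable instance : Norm (EllTwo A) := ⟨fun a => √‖ip a a‖⟩

noncomputable instance : HilbertModule A (EllTwo A) where
  ip := ip
  ip_add_right a b c := by
    have h : ∀ n, star (a n) * (b + c) n = star (a n) * b n + star (a n) * c n :=
      fun n => mul_add _ _ _
    simp only [ip, h]
    exact (summable_star_mul a b).tsum_add (summable_star_mul a c)
  ip_smul_right z a b := by
    have h : ∀ n, star (a n) * (z • b) n = z • (star (a n) * b n) :=
      fun n => mul_smul_comm _ _ _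
    simp only [ip, h]
    exact (summable_star_mul a b).tsum_const_smul z
  ip_op_smul_right c a b := by
    have h : ∀ n, star (a n) * (MulOpposite.op c • b) n = star (a n) * b n * c :=
      fun n => (mul_assoc _ _ _).symm
    simp only [ip, h]
    exact (summable_star_mul a b).tsum_mul_right c
  star_ip a b := by
    simp only [ip, tsum_star, star_mul, star_star]
  ip_self_nonneg a := tsum_nonneg fun n => star_mul_self_nonneg _
  ip_self a := by
    constructor
    · intro h
      have h1 := (hasSum_zero_iff_of_nonneg (fun n => star_mul_self_nonneg (a n))).mp
        (by
          have h2 := (summable_star_mul a a).hasSum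
          change HasSum _ (ip a a) at h2
          rwa [h] at h2)
      refine Subtype.ext (funext fun n => ?_)
      exact (CStarRing.star_mul_self_eq_zero_iff _).mp (congrFun h1 n)
    · rintro rfl
      have h : ∀ n, (0 : EllTwo A) n = 0 := fun n => rfl
      simp [ip, h]
  norm_eq a := rfl

end EllTwo

end EllTwo

/-! ### The multiplier module, frames and outer frames -/

section Frames

variable (A X : Type*) [NonUnitalCStarAlgebra A] [PartialOrder A] [StarOrderedRing A]
  [NormedAddCommGroup X] [NormedSpace ℂ X] [SMul Aᵐᵒᵖ X] [HilbertModule A X]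

/-- The multiplier module `M(X) = 𝔹(A, X)`. For `v ∈ M(X)` and `a ∈ A`, the element `v a ∈ X` is
the value `v a` of the operator. -/
abbrev MultiplierModule : Type _ := Adjointable A A X

variable {A X}

/-- The inner product `⟨v, x⟩ = v⋆ x ∈ A` of `v ∈ M(X)` and `x ∈ X`. -/
def MultiplierModule.pair (v : MultiplierModule A X) (x : X) : A := v.adjoint x

variable (A) in
/-- The inclusion `X ⊆ M(X)`: `x ∈ X` is the operator `a ↦ x a`, whose adjoint is
`y ↦ ⟨x, y⟩`. -/
def MultiplierModule.ofModule (x : X) : MultiplierModule A X where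
  toFun a := MulOpposite.op a • x
  adjFun y := HilbertModule.ip x y
  ip_adj a y := by
    rw [← HilbertModule.star_ip, HilbertModule.ip_op_smul_right, star_mul, HilbertModule.star_ip]
    rfl

variable (A) in
/-- `(xₙ)` in `X` is a frame for `X`: with constants `C, D > 0`,
`C⟨x, x⟩ ≤ ∑ ⟨x, xₙ⟩⟨xₙ, x⟩ ≤ D⟨x, x⟩` for all `x ∈ X`, the series converging in norm. -/
def IsFrame (u : ℕ → X) : Prop :=
  ∃ C D : ℝ, 0 < C ∧ 0 < D ∧ ∀ x : X, ∃ s : A,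
    SeriesTo (fun n => (HilbertModule.ip x (u n) * HilbertModule.ip (u n) x : A)) s ∧
    C • (HilbertModule.ip x x : A) ≤ s ∧ s ≤ D • (HilbertModule.ip x x : A)

/-- `(vₙ)` in `M(X)` is an outer frame for `X`: some `vₙ` is not in `X`, and with constants
`C, D > 0`, `C⟨x, x⟩ ≤ ∑ ⟨x, vₙ⟩⟨vₙ, x⟩ ≤ D⟨x, x⟩` for all `x ∈ X`, the series converging in norm
(where `⟨x, vₙ⟩ = ⟨vₙ, x⟩⋆`). -/
def IsOuterFrame (v : ℕ → MultiplierModule A X) : Prop :=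
  (∃ n, v n ∉ Set.range (MultiplierModule.ofModule A (X := X))) ∧
  ∃ C D : ℝ, 0 < C ∧ 0 < D ∧ ∀ x : X, ∃ s : A,
    SeriesTo (fun n => star ((v n).pair x) * (v n).pair x) s ∧
    C • (HilbertModule.ip x x : A) ≤ s ∧ s ≤ D • (HilbertModule.ip x x : A)

/-- A sequence in `M(X)` which is a frame (in particular, it lies in `X`) or an outer frame. -/
def IsFrameOrOuterFrame (v : ℕ → MultiplierModule A X) : Prop :=
  (∃ u : ℕ → X, IsFrame A u ∧ v = fun n => MultiplierModule.ofModule A (u n)) ∨ IsOuterFrame v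

/-- `U ∈ 𝔹(X, ℓ²(A))` is the analysis operator of `(vₙ)`: `U x = (⟨vₙ, x⟩)ₙ`. -/
def IsAnalysisOperator (U : Adjointable A X (EllTwo A)) (v : ℕ → MultiplierModule A X) : Prop :=
  ∀ (x : X) (n : ℕ), U x n = (v n).pair x

/-- `(wₙ)` is a frame or an outer frame dual to `(vₙ)`: `∑ wₙ⟨vₙ, x⟩ = x` for all `x ∈ X`, with
convergence in the norm of `X`. -/
def IsDualTo (w v : ℕ → MultiplierModule A X) : Prop :=
  IsFrameOrOuterFrame w ∧ ∀ x : X, SeriesTo (fun n => w n ((v n).pair x)) x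

end Frames

/-! Analysis operators translate the statement into operator algebra. Let `U` be the analysis
operator of `(vₙ)` and `V` that of `(wₙ)`. The frame inequality bounds `⟨U x, U x⟩` between
multiples of `⟨x, x⟩`, and reconstruction says `V⋆ U = I`, equivalently `U⋆ V = I`. Every
adjointable `V : X → ℓ²(A)` is the analysis operator of a sequence in `M(X)`, and `V⋆ U = I` alone
forces a lower frame bound on it (`isDualTo_iff`). So the duals correspond exactly to the solutions
of `U⋆ V = I`.

With `S = (U⋆ U)⁻¹`, one solution is `U S`, and `I - U S U⋆` maps onto the kernel of `U⋆`; this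
gives the parametrization. For any solution `V`, the difference `V - U S` is orthogonal to the range
of `U`, so Pythagoras gives minimality.

The analytic inputs are the convergence of `∑ vₙ aₙ`, which makes `U` adjointable
(`FrameBounds.exists_isAnalysisOperator`), the bound `⟨T x, T x⟩ ≤ K⟨x, x⟩`, and the invertibility
of `T⋆ T` when `T` is bounded below. The last two use only Cauchy-Schwarz, the closed graph theorem
and a Neumann series. -/

namespace HilbertModule

/-! ### Algebra of the inner product -/

section Algebra

variable {A X : Type*} [NonUnitalCStarAlgebra A] [PartialOrder A]
  [AddCommGroup X] [Module ℂ X] [SMul Aᵐᵒᵖ X] [Norm X] [HilbertModule A X]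

theorem ip_op_smul_left (a : A) (x y : X) :
    (ip (MulOpposite.op a • x) y : A) = star a * ip x y := by
  rw [← star_ip, ip_op_smul_right, star_mul, star_ip]

theorem ip_zero_right (x : X) : (ip x 0 : A) = 0 := by
  simpa using ip_sub_right (A := A) x 0 0

theorem ip_sum_right {ι : Type*} (s : Finset ι) (x : X) (f : ι → X) :
    (ip x (∑ i ∈ s, f i) : A) = ∑ i ∈ s, ip x (f i) := by
  classical
  induction s using Finset.induction_on with
  | empty => simp [ip_zero_right]
  | insert a s ha ih => rw [Finset.sum_insert ha, Finset.sum_insert ha, ip_add_right, ih]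

theorem ip_ofReal_smul_right (r : ℝ) (x y : X) : (ip x ((r : ℂ) • y) : A) = r • ip x y := by
  rw [ip_smul_right, Complex.coe_smul]

theorem ip_ofReal_smul_left (r : ℝ) (x y : X) : (ip ((r : ℂ) • x) y : A) = r • ip x y := by
  rw [ip_smul_left, Complex.star_def, Complex.conj_ofReal, Complex.coe_smul]

variable (A) in
theorem norm_sq_eq (x : X) : ‖x‖ ^ 2 = ‖(ip x x : A)‖ := by
  rw [norm_eq (A := A), Real.sq_sqrt (norm_nonneg _)]

end Algebra

/-! ### Cauchy-Schwarz and order bounds for symmetric operators -/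

section SemiInner

variable {A X : Type*} [NonUnitalCStarAlgebra A] [PartialOrder A] [StarOrderedRing A]
  [AddCommGroup X] [Module ℂ X] [SMul Aᵐᵒᵖ X] [Norm X] [HilbertModule A X]

/-- The Cauchy-Schwarz inequality for the semi-inner product `⟨x, R y⟩` of a positive `R`. -/
theorem norm_ip_symmetric_sq_le (R : X → X) (hR : ∀ x y : X, (ip (R x) y : A) = ip x (R y))
    (hpos : ∀ x : X, (0 : A) ≤ ip x (R x)) (x y : X) :
    ‖(ip x (R y) : A)‖ ^ 2 ≤ ‖(ip x (R x) : A)‖ * ‖(ip y (R y) : A)‖ := by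
  set c : A := ip x (R y) with hc
  set p : A := ip x (R x) with hp
  set q : A := ip y (R y) with hq
  have hq0 : 0 ≤ ‖q‖ := norm_nonneg q
  have hp0 : 0 ≤ ‖p‖ := norm_nonneg p
  -- Expand `0 ≤ ⟨z, R z⟩` for `z = x (t c) - y` and use `c⋆ p c ≤ ‖p‖ c⋆ c`. The optimal choice is
  -- `t = ‖p‖⁻¹`; if `p = 0`, a large `t` forces `c = 0`.
  have key : ∀ t : ℝ, 0 ≤ 2 * t - t ^ 2 * ‖p‖ → (2 * t - t ^ 2 * ‖p‖) * ‖c‖ ^ 2 ≤ ‖q‖ := by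
    intro t ht
    have h1 : (ip (MulOpposite.op (t • c) • x - y) (R (MulOpposite.op (t • c) • x - y)) : A)
        = (t ^ 2) • (star c * p * c) - (2 * t) • (star c * c) + q := by
      have e1 : (ip (R x) y : A) = c := by rw [hR]
      have e2 : (ip (R y) x : A) = star c := by rw [hc, star_ip]
      have e3 : (ip (R x) x : A) = p := by rw [hR]
      have e4 : (ip (R y) y : A) = q := by rw [hR]
      rw [ip_sub_left, ip_op_smul_left, ← hR x, ← hR y, ip_sub_right, ip_sub_right,
        ip_op_smul_right, ip_op_smul_right, e1, e2, e3, e4]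
      have e5 : star (t • c) = t • star c := by rw [star_smul]; simp
      rw [e5]
      simp only [mul_sub, smul_mul_assoc, mul_smul_comm, mul_assoc]
      module
    have h2 : (0 : A) ≤ (t ^ 2) • (star c * p * c) - (2 * t) • (star c * c) + q :=
      h1 ▸ hpos _
    have h3 : star c * p * c ≤ ‖p‖ • (star c * c) :=
      CStarAlgebra.star_left_conjugate_le_norm_smul (hpos x).isSelfAdjoint
    have h4 : (2 * t - t ^ 2 * ‖p‖) • (star c * c) ≤ q := by
      have h5 := smul_le_smul_of_nonneg_left h3 (sq_nonneg t)
      rw [smul_smul] at h5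
      rw [sub_smul, sub_le_iff_le_add]
      rw [sub_add_eq_add_sub, sub_nonneg] at h2
      exact h2.trans (by rw [add_comm q]; exact add_le_add_left h5 q)
    have h6 := CStarAlgebra.norm_le_norm_of_nonneg_of_le
      (smul_nonneg ht (star_mul_self_nonneg c)) h4
    rwa [norm_smul, CStarRing.norm_star_mul_self, Real.norm_of_nonneg ht, ← sq] at h6
  rcases hp0.eq_or_lt with h0 | h0
  · rw [← h0] at key ⊢
    by_contra! hk
    rw [zero_mul] at hk
    have h := key ((‖q‖ + 1) / ‖c‖ ^ 2) (by simp; positivity)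
    have h' : (2 * ((‖q‖ + 1) / ‖c‖ ^ 2) - ((‖q‖ + 1) / ‖c‖ ^ 2) ^ 2 * 0) * ‖c‖ ^ 2
        = 2 * (‖q‖ + 1) := by
      have hk' := hk.ne'
      rw [mul_zero, sub_zero, mul_assoc, div_mul_cancel₀ _ hk']
    linarith
  · have e : 2 * ‖p‖⁻¹ - ‖p‖⁻¹ ^ 2 * ‖p‖ = ‖p‖⁻¹ := by field_simp; ring
    have h := key ‖p‖⁻¹ (by rw [e]; positivity)
    rw [e] at h
    calc ‖c‖ ^ 2 = ‖p‖ * (‖p‖⁻¹ * ‖c‖ ^ 2) := by field_simp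
      _ ≤ ‖p‖ * ‖q‖ := mul_le_mul_of_nonneg_left h hp0

/-- The Cauchy-Schwarz inequality. -/
theorem norm_ip_le (x y : X) : ‖(ip x y : A)‖ ≤ ‖x‖ * ‖y‖ := by
  have hx : 0 ≤ ‖x‖ := by rw [norm_eq (A := A)]; positivity
  have hy : 0 ≤ ‖y‖ := by rw [norm_eq (A := A)]; positivity
  refine (pow_le_pow_iff_left₀ (norm_nonneg _) (mul_nonneg hx hy) two_ne_zero).mp ?_
  rw [mul_pow, norm_sq_eq A x, norm_sq_eq A y]
  exact norm_ip_symmetric_sq_le (fun x => x) (fun _ _ => rfl) ip_self_nonneg x y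

/-- A symmetric operator of norm at most `K` satisfies `⟨x, T x⟩ ≤ K⟨x, x⟩` up to an error which
can be made arbitrarily small. -/
theorem ip_symmetric_le_aux (n : ℕ) : ∀ (T : X → X) (K : ℝ), 0 < K →
    (∀ x y : X, (ip (T x) y : A) = ip x (T y)) → (∀ x, ‖T x‖ ≤ K * ‖x‖) → ∀ x : X,
    ∃ r : A, ‖r‖ ≤ 2⁻¹ ^ n * K * ‖x‖ ^ 2 ∧
      (ip x (T x) : A) ≤ (K * (1 - 2⁻¹ ^ n)) • ip x x + r := by
  induction n with
  | zero =>
    intro T K hK hT hb x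
    have hx : 0 ≤ ‖x‖ := by rw [norm_eq (A := A)]; positivity
    refine ⟨ip x (T x), (norm_ip_le x (T x)).trans ?_, by simp⟩
    nlinarith [mul_le_mul_of_nonneg_left (hb x) hx]
  | succ n ih =>
    intro T K hK hT hb x
    -- Since `(K - T)² ≥ 0`, `T ≤ K/2 + T²/(2K)`. Applying the induction hypothesis to `T²` with
    -- bound `K²` halves the error term.
    obtain ⟨r, hr, hle⟩ := ih (fun x => T (T x)) (K ^ 2) (by positivity)
      (fun x y => by rw [hT, hT]) (fun x => by nlinarith [hb x, hb (T x)]) x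
    refine ⟨(2⁻¹ * K⁻¹) • r, ?_, ?_⟩
    · rw [norm_smul, Real.norm_of_nonneg (by positivity)]
      calc 2⁻¹ * K⁻¹ * ‖r‖ ≤ 2⁻¹ * K⁻¹ * (2⁻¹ ^ n * K ^ 2 * ‖x‖ ^ 2) := by gcongr
        _ = 2⁻¹ ^ (n + 1) * K * ‖x‖ ^ 2 := by field_simp; ring
    · have h1 : (0 : A) ≤ ip ((K : ℂ) • x - T x) ((K : ℂ) • x - T x) := ip_self_nonneg _
      rw [ip_sub_left, ip_sub_right, ip_sub_right, ip_ofReal_smul_left, ip_ofReal_smul_left,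
        ip_ofReal_smul_right, ip_ofReal_smul_right, hT, hT, smul_smul] at h1
      have h2 : (ip x (T x) : A)
          ≤ (2⁻¹ * K) • ip x x + (2⁻¹ * K⁻¹) • ip x (T (T x)) := by
        have h3 := smul_nonneg (show (0 : ℝ) ≤ 2⁻¹ * K⁻¹ by positivity) h1
        rw [← sub_nonneg]
        convert h3 using 1
        match_scalars <;> field_simp
        norm_num
      refine h2.trans ?_
      have h4 := smul_le_smul_of_nonneg_left hle (show (0 : ℝ) ≤ 2⁻¹ * K⁻¹ by positivity)
      refine (add_le_add_right h4 _).trans_eq ?_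
      match_scalars <;> field_simp
      ring

/-- Let the error tend to zero; the order on `A` is closed. -/
theorem ip_symmetric_le (T : X → X) {K : ℝ} (hK : 0 < K)
    (hT : ∀ x y : X, (ip (T x) y : A) = ip x (T y)) (hb : ∀ x, ‖T x‖ ≤ K * ‖x‖) (x : X) :
    (ip x (T x) : A) ≤ K • ip x x := by
  choose r hr hle using fun n => ip_symmetric_le_aux n T K hK hT hb x
  have h2 : Tendsto (fun n : ℕ => (2⁻¹ : ℝ) ^ n) atTop (𝓝 0) :=
    tendsto_pow_atTop_nhds_zero_of_lt_one (by norm_num) (by norm_num)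
  have h0 : Tendsto r atTop (𝓝 0) :=
    squeeze_zero_norm hr (by simpa using (h2.mul_const K).mul_const (‖x‖ ^ 2))
  have h1 : Tendsto (fun n : ℕ => (K * (1 - 2⁻¹ ^ n)) • (ip x x : A) + r n) atTop
      (𝓝 (K • ip x x)) := by
    simpa using (((h2.const_sub 1).const_mul K).smul_const (ip x x : A)).add h0
  exact ge_of_tendsto' h1 hle

end SemiInner

section Normed

variable {A X : Type*} [NonUnitalCStarAlgebra A] [PartialOrder A] [StarOrderedRing A]
  [NormedAddCommGroup X] [NormedSpace ℂ X] [SMul Aᵐᵒᵖ X] [HilbertModule A X]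

variable (A) in
/-- `⟨x, ·⟩` as a continuous linear map. -/
noncomputable def ipCLM (x : X) : X →L[ℂ] A :=
  LinearMap.mkContinuous
    { toFun := fun y => ip x y
      map_add' := ip_add_right x
      map_smul' := fun c y => ip_smul_right c x y } ‖x‖ (norm_ip_le x)

theorem ipCLM_apply (x y : X) : ipCLM A x y = ip x y := rfl

end Normed

end HilbertModule

/-! ### Boundedness and invertibility of adjointable operators -/

namespace Adjointable

open HilbertModule

section Linear

variable {A X Y Z : Type*} [NonUnitalCStarAlgebra A] [PartialOrder A]
  [AddCommGroup X] [Module ℂ X] [SMul Aᵐᵒᵖ X] [Norm X] [HilbertModule A X]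
  [AddCommGroup Y] [Module ℂ Y] [SMul Aᵐᵒᵖ Y] [Norm Y] [HilbertModule A Y]
  [AddCommGroup Z] [Module ℂ Z] [SMul Aᵐᵒᵖ Z] [Norm Z] [HilbertModule A Z]

theorem ip_adj' (T : Adjointable A X Y) (y : Y) (x : X) :
    (ip (T.adjFun y) x : A) = ip y (T x) := T.adjoint.ip_adj y x

theorem map_add (T : Adjointable A X Y) (x y : X) : T (x + y) = T x + T y :=
  ext_ip A fun z => by simp only [← ip_adj', ip_add_right]

theorem map_sub (T : Adjointable A X Y) (x y : X) : T (x - y) = T x - T y :=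
  ext_ip A fun z => by simp only [← ip_adj', ip_sub_right]

theorem map_smul (T : Adjointable A X Y) (c : ℂ) (x : X) : T (c • x) = c • T x :=
  ext_ip A fun z => by simp only [← ip_adj', ip_smul_right]

theorem comp_apply (S : Adjointable A Y Z) (T : Adjointable A X Y) (x : X) :
    S.comp T x = S (T x) := rfl

theorem adjoint_apply (T : Adjointable A X Y) (y : Y) : T.adjoint y = T.adjFun y := rfl

end Linear

section Bounded

variable {A X : Type*} [NonUnitalCStarAlgebra A] [PartialOrder A] [StarOrderedRing A]
  [NormedAddCommGroup X] [NormedSpace ℂ X] [CompleteSpace X] [SMul Aᵐᵒᵖ X] [HilbertModule A X]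

/-- Adjointable operators on a Hilbert module are bounded, by the closed graph theorem. -/
theorem continuous (T : Adjointable A X X) : Continuous T := by
  let g : X →ₗ[ℂ] X := ⟨⟨T, T.map_add⟩, T.map_smul⟩
  refine g.continuous_of_seq_closed_graph fun u x y hu hgu => ext_ip A fun z => ?_
  have h1 := ((ipCLM A z).continuous.tendsto y).comp hgu
  have h2 := ((ipCLM A (T.adjFun z)).continuous.tendsto x).comp hu
  have h3 : (ip z y : A) = ip (T.adjFun z) x :=
    tendsto_nhds_unique h1 (h2.congr fun n => T.ip_adj' z (u n))
  rw [h3, ip_adj']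
  rfl

/-- An adjointable operator on a Hilbert module as a continuous linear map. -/
def toCLM (T : Adjointable A X X) : X →L[ℂ] X where
  toFun := T
  map_add' := T.map_add
  map_smul' := T.map_smul
  cont := T.continuous

/-- The inequality `⟨T x, T x⟩ ≤ K⟨x, x⟩` for an adjointable operator `T`. -/
theorem exists_ip_map_self_le {Y : Type*} [AddCommGroup Y] [Module ℂ Y] [SMul Aᵐᵒᵖ Y] [Norm Y]
    [HilbertModule A Y] (T : Adjointable A X Y) :
    ∃ K : ℝ, 0 < K ∧ ∀ x : X, (ip (T x) (T x) : A) ≤ K • ip x x := by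
  -- `T⋆ T` acts on `X`, so the closed graph theorem applies to it without completeness of `Y`.
  set R := T.adjoint.comp T
  refine ⟨‖R.toCLM‖ + 1, by positivity, fun x => ?_⟩
  rw [T.ip_adj]
  refine ip_symmetric_le R (by positivity) (fun y z => ?_) (fun y => ?_) x
  · exact (T.ip_adj' (T y) z).trans (T.ip_adj y (T z))
  · refine (R.toCLM.le_opNorm y).trans ?_
    gcongr
    linarith

/-- An adjointable `T` which is bounded below has an invertible `T⋆ T`. -/
theorem exists_inverse_adjoint_comp {Y : Type*} [AddCommGroup Y] [Module ℂ Y] [SMul Aᵐᵒᵖ Y]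
    [Norm Y] [HilbertModule A Y] (T : Adjointable A X Y) {C : ℝ} (hC : 0 < C)
    (h : ∀ x : X, C • (ip x x : A) ≤ ip (T x) (T x)) :
    ∃ S : Adjointable A X X, S.comp (T.adjoint.comp T) = Adjointable.id A X ∧
      (T.adjoint.comp T).comp S = Adjointable.id A X ∧
      ∀ x y : X, (ip (S x) y : A) = ip x (S y) := by
  obtain ⟨K, hK, hT⟩ := T.exists_ip_map_self_le
  set P := T.adjoint.comp T with hP
  have hPs : ∀ x y : X, (ip (P x) y : A) = ip x (P y) := fun x y =>
    (T.ip_adj' (T x) y).trans (T.ip_adj x (T y))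
  have hPx : ∀ x : X, (ip x (P x) : A) = ip (T x) (T x) := fun x => (T.ip_adj x (T x)).symm
  -- From `C ≤ P ≤ K`, `R = 1 - P/D` satisfies `0 ≤ R ≤ 1 - C/D = K/D < 1`, so `P/D = 1 - R` is
  -- inverted by a Neumann series.
  set D := C + K with hD
  have hD0 : 0 < D := by positivity
  set R : X →L[ℂ] X := 1 - ((D⁻¹ : ℝ) : ℂ) • P.toCLM with hR
  have hRa : ∀ x, R x = x - ((D⁻¹ : ℝ) : ℂ) • P x := fun x => rfl
  have hRx : ∀ x : X, (ip x (R x) : A) = ip x x - D⁻¹ • ip (T x) (T x) := fun x => by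
    rw [hRa, ip_sub_right, ip_ofReal_smul_right, hPx]
  have hRs : ∀ x y : X, (ip (R x) y : A) = ip x (R y) := fun x y => by
    rw [hRa, hRa, ip_sub_right, ip_ofReal_smul_right, ip_sub_left, ip_ofReal_smul_left, hPs]
  have hR0 : ∀ x : X, (0 : A) ≤ ip x (R x) := fun x => by
    rw [hRx, sub_nonneg]
    have h1 := (hT x).trans (smul_le_smul_of_nonneg_right (show K ≤ D by linarith)
      (ip_self_nonneg (A := A) x))
    simpa [smul_smul, hD0.ne'] using smul_le_smul_of_nonneg_left h1 (inv_nonneg.mpr hD0.le)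
  have hq0 : 0 ≤ K / D := by positivity
  have hRq : ∀ x : X, ‖(ip x (R x) : A)‖ ≤ K / D * ‖x‖ ^ 2 := fun x => by
    have h1 : (ip x (R x) : A) ≤ (K / D) • ip x x := by
      rw [hRx, sub_le_iff_le_add]
      have h2 := smul_le_smul_of_nonneg_left (h x) (inv_nonneg.mpr hD0.le)
      refine le_trans (le_of_eq ?_) (add_le_add_right h2 _)
      match_scalars
      field_simp
      linarith
    have h3 := CStarAlgebra.norm_le_norm_of_nonneg_of_le (hR0 x) h1
    rwa [norm_smul, Real.norm_of_nonneg hq0, ← norm_sq_eq] at h3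
  have hRn : ‖R‖ ≤ K / D := by
    refine R.opNorm_le_bound hq0 fun x => ?_
    -- Cauchy-Schwarz for the form of `R` turns the form bound into a norm bound: `‖R x‖⁴ ≤ ‖⟨R x,
    -- R² x⟩‖ ‖⟨x, R x⟩‖ ≤ (K/D)² ‖R x‖² ‖x‖²`.
    have h1 := norm_ip_symmetric_sq_le (A := A) R hRs hR0 (R x) x
    rw [← norm_sq_eq] at h1
    have h2 := h1.trans (mul_le_mul (hRq (R x)) (hRq x) (norm_nonneg _) (by positivity))
    rcases (norm_nonneg (R x)).eq_or_lt with h0 | h0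
    · rw [← h0]; positivity
    · refine (pow_le_pow_iff_left₀ h0.le (by positivity) two_ne_zero).mp ?_
      refine le_of_mul_le_mul_left ?_ (show 0 < ‖R x‖ ^ 2 by positivity)
      calc ‖R x‖ ^ 2 * ‖R x‖ ^ 2 = (‖R x‖ ^ 2) ^ 2 := by ring
        _ ≤ _ := h2
        _ = _ := by ring
  have hlt : ‖R‖ < 1 := hRn.trans_lt ((div_lt_one hD0).mpr (by linarith))
  obtain ⟨u, hu⟩ := isUnit_one_sub_of_norm_lt_one hlt
  have hu' : (u : X →L[ℂ] X) = ((D⁻¹ : ℝ) : ℂ) • P.toCLM := by rw [hu, hR, sub_sub_cancel]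
  set S₀ : X → X := fun x => ((D⁻¹ : ℝ) : ℂ) • (↑u⁻¹ : X →L[ℂ] X) x with hS₀
  have hPS : ∀ x, P (S₀ x) = x := fun x => by
    have h1 : (u : X →L[ℂ] X) ((↑u⁻¹ : X →L[ℂ] X) x) = x := by
      rw [← mul_apply_eq_comp, u.mul_inv, one_apply_eq_self]
    rw [hu'] at h1
    rw [hS₀, map_smul]
    exact h1
  have hSP : ∀ x, S₀ (P x) = x := fun x => by
    have h1 : (↑u⁻¹ : X →L[ℂ] X) ((u : X →L[ℂ] X) x) = x := by
      rw [← mul_apply_eq_comp, u.inv_mul, one_apply_eq_self]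
    rw [hu', smul_apply, _root_.map_smul] at h1
    exact h1
  have hSs : ∀ x y : X, (ip (S₀ x) y : A) = ip x (S₀ y) := fun x y => by
    conv_lhs => rw [← hPS y]
    rw [← hPs, hPS]
  exact ⟨⟨S₀, S₀, hSs⟩, ext hSP, ext hPS, hSs⟩

end Bounded

end Adjointable

open HilbertModule

/-! ### Finitely supported sequences in `ℓ²(A)` -/

namespace EllTwo

variable {A : Type*} [NonUnitalCStarAlgebra A] [PartialOrder A] [StarOrderedRing A]

theorem hasSum_ip (a b : EllTwo A) :
    HasSum (fun n => star (a n) * b n) (HilbertModule.ip a b : A) :=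
  (summable_star_mul a b).hasSum

/-- The sequence which agrees with `a` on the finite set `F` and vanishes elsewhere. -/
noncomputable def restrict (a : ℕ → A) (F : Finset ℕ) : EllTwo A :=
  ⟨fun n => if n ∈ F then a n else 0,
    summable_of_ne_finset_zero (s := F) fun n hn => by simp [hn]⟩

theorem ip_restrict (b : EllTwo A) (a : ℕ → A) (F : Finset ℕ) :
    (HilbertModule.ip b (restrict a F) : A) = ∑ n ∈ F, star (b n) * a n := by
  refine (tsum_eq_sum (s := F) fun n hn => ?_).trans (Finset.sum_congr rfl fun n hn => ?_)
  · simp [restrict, hn]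
  · simp [restrict, hn]

theorem norm_restrict_sq (a : ℕ → A) (F : Finset ℕ) :
    ‖restrict a F‖ ^ 2 = ‖∑ n ∈ F, star (a n) * a n‖ := by
  rw [norm_sq_eq A, ip_restrict]
  congr 1
  exact Finset.sum_congr rfl fun n hn => by simp [restrict, hn]

/-- The embedding of `A` into `ℓ²(A)` as the `n`-th coordinate. -/
noncomputable def single (n : ℕ) (a : A) : EllTwo A := restrict (fun _ => a) {n}

/-- The adjoint of the `n`-th embedding is thus the `n`-th coordinate map. -/
theorem ip_single (b : EllTwo A) (n : ℕ) (a : A) :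
    (HilbertModule.ip b (single n a) : A) = star (b n) * a := by
  rw [single, ip_restrict, Finset.sum_singleton]

end EllTwo

/-! ### Frames and duality through analysis operators -/

section Frames

variable {A X : Type*} [NonUnitalCStarAlgebra A] [PartialOrder A] [StarOrderedRing A]
  [NormedAddCommGroup X] [NormedSpace ℂ X] [SMul Aᵐᵒᵖ X] [HilbertModule A X]

theorem MultiplierModule.ip_apply (v : MultiplierModule A X) (x : X) (a : A) :
    (HilbertModule.ip x (v a) : A) = star (v.pair x) * a :=
  (v.ip_adj' x a).symm

/-- The sequence `(vₙ)` in `M(X)` satisfies the frame inequality with constants `C`, `D`. -/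
def FrameBounds (v : ℕ → MultiplierModule A X) (C D : ℝ) : Prop :=
  ∀ x : X, ∃ s : A, SeriesTo (fun n => star ((v n).pair x) * (v n).pair x) s ∧
    C • (HilbertModule.ip x x : A) ≤ s ∧ s ≤ D • (HilbertModule.ip x x : A)

/-- Either some member lies outside `X`, or all members come from `X` and the two series agree
termwise. The dichotomy can then be forgotten. -/
theorem isFrameOrOuterFrame_iff {v : ℕ → MultiplierModule A X} :
    IsFrameOrOuterFrame v ↔ ∃ C D : ℝ, 0 < C ∧ 0 < D ∧ FrameBounds v C D := by
  have hpair : ∀ (u : ℕ → X) (x : X) (n : ℕ),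
      (star ((MultiplierModule.ofModule A (u n)).pair x) *
        (MultiplierModule.ofModule A (u n)).pair x : A)
      = HilbertModule.ip x (u n) * HilbertModule.ip (u n) x := fun u x n => by
    rw [← star_ip (u n) x]
    rfl
  constructor
  · rintro (⟨u, ⟨C, D, hC, hD, h⟩, rfl⟩ | ⟨-, h⟩)
    · refine ⟨C, D, hC, hD, fun x => ?_⟩
      simpa only [hpair] using h x
    · exact h
  · intro h
    by_cases hm : ∃ n, v n ∉ Set.range (MultiplierModule.ofModule A (X := X))
    · exact Or.inr ⟨hm, h⟩
    · push Not at hm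
      choose u hu using hm
      obtain rfl : (fun n => MultiplierModule.ofModule A (u n)) = v := funext hu
      obtain ⟨C, D, hC, hD, h⟩ := h
      refine Or.inl ⟨u, ⟨C, D, hC, hD, fun x => ?_⟩, rfl⟩
      simpa only [hpair] using h x

theorem SeriesTo.hasSum_of_nonneg {f : ℕ → A} {s : A} (hf : ∀ n, 0 ≤ f n) (h : SeriesTo f s) :
    HasSum f s := by
  have h1 := ((summable_iff_exists_seriesTo hf).mpr ⟨s, h⟩).hasSum
  rwa [tendsto_nhds_unique h1.tendsto_sum_nat h] at h1

theorem IsAnalysisOperator.hasSum {U : Adjointable A X (EllTwo A)} {v : ℕ → MultiplierModule A X}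
    (hU : IsAnalysisOperator U v) (x : X) :
    HasSum (fun n => star ((v n).pair x) * (v n).pair x) (HilbertModule.ip (U x) (U x) : A) := by
  simpa only [hU x] using EllTwo.hasSum_ip (U x) (U x)

theorem IsAnalysisOperator.frameBounds_iff {U : Adjointable A X (EllTwo A)}
    {v : ℕ → MultiplierModule A X} (hU : IsAnalysisOperator U v) {C D : ℝ} :
    FrameBounds v C D ↔ ∀ x : X, C • (HilbertModule.ip x x : A) ≤ HilbertModule.ip (U x) (U x) ∧
      (HilbertModule.ip (U x) (U x) : A) ≤ D • (HilbertModule.ip x x : A) := by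
  refine forall_congr' fun x => ⟨?_, fun h => ⟨_, (hU.hasSum x).tendsto_sum_nat, h⟩⟩
  rintro ⟨s, hs, h⟩
  rwa [tendsto_nhds_unique hs (hU.hasSum x).tendsto_sum_nat] at h

theorem IsAnalysisOperator.unique {U V : Adjointable A X (EllTwo A)}
    {v : ℕ → MultiplierModule A X} (hU : IsAnalysisOperator U v) (hV : IsAnalysisOperator V v) :
    U = V :=
  Adjointable.ext fun x => Subtype.ext (funext fun n => (hU x n).trans (hV x n).symm)

/-- The sequence in `M(X)` with analysis operator `V`. -/
noncomputable def Adjointable.coordinates (V : Adjointable A X (EllTwo A)) (n : ℕ) :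
    MultiplierModule A X where
  toFun a := V.adjFun (EllTwo.single n a)
  adjFun x := V x n
  ip_adj a x := by
    rw [V.ip_adj', ← star_ip, EllTwo.ip_single, star_mul, star_star]
    rfl

/-- Every adjointable `V` arises this way because the `n`-th member, `V⋆` after the `n`-th embedding
of `A`, only has to lie in `M(X)`. -/
theorem Adjointable.isAnalysisOperator_coordinates (V : Adjointable A X (EllTwo A)) :
    IsAnalysisOperator V V.coordinates := fun _ _ => rfl

variable [CompleteSpace X]

/-- The analysis operator of a sequence satisfying the frame inequality, with adjoint
`(aₙ) ↦ ∑ vₙ aₙ`. -/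
theorem FrameBounds.exists_isAnalysisOperator {v : ℕ → MultiplierModule A X} {C D : ℝ}
    (hD : 0 < D) (h : FrameBounds v C D) :
    ∃ U : Adjointable A X (EllTwo A), IsAnalysisOperator U v ∧
      ∀ a : EllTwo A, HasSum (fun n => v n (a n)) (U.adjFun a) := by
  choose s hs _ hsD using h
  have hs' : ∀ x, HasSum (fun n => star ((v n).pair x) * (v n).pair x) (s x) := fun x =>
    (hs x).hasSum_of_nonneg fun n => star_mul_self_nonneg _
  let P : X → EllTwo A := fun x => ⟨fun n => (v n).pair x, (hs' x).summable⟩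
  have hP : ∀ x, ‖P x‖ ^ 2 ≤ D * ‖x‖ ^ 2 := fun x => by
    have h1 : (HilbertModule.ip (P x) (P x) : A) = s x :=
      (EllTwo.hasSum_ip (P x) (P x)).unique (hs' x)
    have h2 := CStarAlgebra.norm_le_norm_of_nonneg_of_le
      (h1 ▸ ip_self_nonneg (P x) : (0 : A) ≤ s x) (hsD x)
    rwa [norm_smul, Real.norm_of_nonneg hD.le, ← norm_sq_eq, ← h1, ← norm_sq_eq] at h2
  -- For `y = ∑ vₙ aₙ` over `F`, `⟨y, y⟩ = ⟨P y, a|F⟩`; Cauchy-Schwarz and `‖P y‖² ≤ D ‖y‖²` then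
  -- bound `‖y‖`.
  have hbd : ∀ (a : ℕ → A) (F : Finset ℕ),
      ‖∑ n ∈ F, v n (a n)‖ ^ 2 ≤ D * ‖∑ n ∈ F, star (a n) * a n‖ := fun a F => by
    set y := ∑ n ∈ F, v n (a n) with hy
    have h1 : (HilbertModule.ip y y : A)
        = HilbertModule.ip (P y) (EllTwo.restrict a F) := by
      rw [EllTwo.ip_restrict]
      conv_lhs => rw [hy, ← hy, ip_sum_right]
      exact Finset.sum_congr rfl fun n _ => (v n).ip_apply y (a n)
    have h2 : ‖y‖ ^ 2 ≤ ‖P y‖ * ‖EllTwo.restrict a F‖ := by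
      rw [norm_sq_eq A, h1]
      exact norm_ip_le _ _
    have h3 : (‖y‖ ^ 2) ^ 2 ≤ D * ‖y‖ ^ 2 * ‖∑ n ∈ F, star (a n) * a n‖ := by
      refine (pow_le_pow_left₀ (by positivity) h2 2).trans ?_
      rw [mul_pow, EllTwo.norm_restrict_sq]
      gcongr
      exact hP y
    rcases (norm_nonneg y).eq_or_lt with h0 | h0
    · rw [← h0, zero_pow two_ne_zero]; positivity
    · refine le_of_mul_le_mul_left ?_ (show 0 < ‖y‖ ^ 2 by positivity)
      linarith
  have hsum : ∀ a : EllTwo A, Summable fun n => v n (a n) := fun a => by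
    rw [summable_iff_vanishing_norm]
    intro ε hε
    obtain ⟨F, hF⟩ := summable_iff_vanishing_norm.mp a.2 (ε ^ 2 / D) (by positivity)
    refine ⟨F, fun t ht => ?_⟩
    refine (pow_lt_pow_iff_left₀ (norm_nonneg _) hε.le two_ne_zero).mp ?_
    refine (hbd a t).trans_lt ?_
    have h1 := hF t ht
    rwa [lt_div_iff₀' hD] at h1
  refine ⟨⟨P, fun a => ∑' n, v n (a n), fun x a => ?_⟩, fun _ _ => rfl,
    fun a => (hsum a).hasSum⟩
  have h1 := (hsum a).hasSum.mapL (ipCLM A x)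
  refine (EllTwo.hasSum_ip (P x) a).unique ?_
  simp only [ipCLM_apply, (v _).ip_apply] at h1
  exact h1

/-- Only the upper frame bound matters for convergence, and adjointability supplies it; the lower
constant is taken to be `0`. -/
theorem IsAnalysisOperator.hasSum_adjFun {U : Adjointable A X (EllTwo A)}
    {v : ℕ → MultiplierModule A X} (hU : IsAnalysisOperator U v) (a : EllTwo A) :
    HasSum (fun n => v n (a n)) (U.adjFun a) := by
  obtain ⟨D, hD, h⟩ := U.exists_ip_map_self_le
  have hb : FrameBounds v 0 D := hU.frameBounds_iff.mpr fun x =>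
    ⟨by rw [zero_smul]; exact ip_self_nonneg _, h x⟩
  obtain ⟨U', hU', hs⟩ := hb.exists_isAnalysisOperator hD
  obtain rfl := hU.unique hU'
  exact hs a

/-- Duality in terms of the analysis operators: `(wₙ)` is dual to `(vₙ)` iff `V⋆ U = I`. -/
theorem isDualTo_iff {U V : Adjointable A X (EllTwo A)} {v w : ℕ → MultiplierModule A X}
    (hU : IsAnalysisOperator U v) (hV : IsAnalysisOperator V w) :
    IsDualTo w v ↔ ∀ x, V.adjFun (U x) = x := by
  have hs : ∀ x, SeriesTo (fun n => w n ((v n).pair x)) (V.adjFun (U x)) := fun x => by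
    have h1 := (hV.hasSum_adjFun (U x)).tendsto_sum_nat
    simp only [hU x] at h1
    exact h1
  refine ⟨fun h x => tendsto_nhds_unique (hs x) (h.2 x), fun h => ⟨?_, fun x => ?_⟩⟩
  · obtain ⟨D, hD, hUD⟩ := U.exists_ip_map_self_le
    obtain ⟨E, hE, hVE⟩ := V.exists_ip_map_self_le
    refine isFrameOrOuterFrame_iff.mpr ⟨D⁻¹, E, by positivity, hE,
      hV.frameBounds_iff.mpr fun x => ⟨?_, hVE x⟩⟩
    set c : ℂ := ((D⁻¹ : ℝ) : ℂ) with hc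
    -- The lower bound comes from `⟨V x, U x⟩ = ⟨x, x⟩`: positivity gives `⟨V x, V x⟩ ≥ 2D⁻¹⟨x, x⟩ -
    -- D⁻²⟨U x, U x⟩ ≥ D⁻¹⟨x, x⟩`.
    have h1 : (0 : A) ≤ HilbertModule.ip (V x - c • U x) (V x - c • U x) := ip_self_nonneg _
    have h2 : (HilbertModule.ip (V x) (U x) : A) = HilbertModule.ip x x := by rw [V.ip_adj, h]
    have h3 : (HilbertModule.ip (U x) (V x) : A) = HilbertModule.ip x x := by
      rw [← star_ip, h2, star_ip]
    rw [hc, ip_sub_left, ip_sub_right, ip_sub_right, ip_ofReal_smul_left, ip_ofReal_smul_left,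
      ip_ofReal_smul_right, ip_ofReal_smul_right, h2, h3, smul_smul] at h1
    have h4 := smul_le_smul_of_nonneg_left (hUD x) (show 0 ≤ D⁻¹ * D⁻¹ by positivity)
    rw [← sub_nonneg] at h4 ⊢
    refine (add_nonneg h1 h4).trans_eq ?_
    match_scalars <;> field_simp <;> ring
  · simpa only [h x] using hs x

end Frames
-- Parametrization of the duals and minimality of the canonical dual
theorem theorem4p4 {A X : Type*} [NonUnitalCStarAlgebra A] [PartialOrder A] [StarOrderedRing A]
    [NormedAddCommGroup X] [NormedSpace ℂ X] [CompleteSpace X] [SMul Aᵐᵒᵖ X] [HilbertModule A X]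
    (v : ℕ → MultiplierModule A X) (hv : IsFrameOrOuterFrame v) :
    ∃ U : Adjointable A X (EllTwo A), IsAnalysisOperator U v ∧
    -- `S = (U⋆ U)⁻¹` in `𝔹(X)`
    ∃ S : Adjointable A X X,
      S.comp (U.adjoint.comp U) = Adjointable.id A X ∧
      (U.adjoint.comp U).comp S = Adjointable.id A X ∧
      -- the analysis operators of the duals
      (∀ V : Adjointable A X (EllTwo A),
        (∃ w : ℕ → MultiplierModule A X, IsDualTo w v ∧ IsAnalysisOperator V w) ↔
        ∃ L : Adjointable A X (EllTwo A),
          V = U.comp S + (Adjointable.id A (EllTwo A) - (U.comp S).comp U.adjoint).comp L) ∧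
      -- the canonical dual `(S vₙ)` is a dual, and its frame coefficients are minimal
      IsDualTo (fun n => S.comp (v n)) v ∧
      ∀ w : ℕ → MultiplierModule A X, IsDualTo w v → ∀ x : X, ∃ s t : A,
        SeriesTo (fun n => star (MultiplierModule.pair (S.comp (v n)) x) *
          MultiplierModule.pair (S.comp (v n)) x) s ∧
        SeriesTo (fun n => star (MultiplierModule.pair (w n) x) * MultiplierModule.pair (w n) x) t ∧ s ≤ t := by
  obtain ⟨C, D, hC, hD, hb⟩ := isFrameOrOuterFrame_iff.mp hv
  obtain ⟨U, hU, -⟩ := hb.exists_isAnalysisOperator hD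
  obtain ⟨S, hSU, hUS, hSs⟩ := U.exists_inverse_adjoint_comp hC
    fun x => (hU.frameBounds_iff.mp hb x).1
  have hS : ∀ x, U.adjFun (U (S x)) = x := fun x => congrArg (fun T => T.toFun x) hUS
  have hadj : ∀ V : Adjointable A X (EllTwo A),
      (∀ x, V.adjFun (U x) = x) ↔ ∀ x, U.adjFun (V x) = x := fun V => by
    constructor <;> intro h x <;> refine ext_ip A fun z => ?_
    · rw [← U.ip_adj, ← V.ip_adj', h]
    · rw [← V.ip_adj, ← U.ip_adj', h]
  have hS' : ∀ x, S.adjFun x = S x := fun x => ext_ip A fun z => by rw [← S.ip_adj, hSs]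
  have hcan : IsAnalysisOperator (U.comp S) fun n => S.comp (v n) := fun x n => by
    refine (hU (S x) n).trans ?_
    rw [← hS' x]
    rfl
  refine ⟨U, hU, S, hSU, hUS, fun V => ⟨?_, ?_⟩, ?_, fun w hw x => ?_⟩
  · rintro ⟨w, hw, hV⟩
    have h := (hadj V).mp ((isDualTo_iff hU hV).mp hw)
    -- `L = V` works: `U⋆ V = I` gives `(I - U S U⋆) V = V - U S`.
    refine ⟨V, Adjointable.ext fun x => ?_⟩
    change V x = U (S x) + (V x - U (S (U.adjFun (V x))))
    rw [h, add_sub_cancel]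
  · rintro ⟨L, rfl⟩
    refine ⟨_, (isDualTo_iff hU (Adjointable.isAnalysisOperator_coordinates _)).mpr
      ((hadj _).mpr fun x => ?_), Adjointable.isAnalysisOperator_coordinates _⟩
    change U.adjoint (U (S x) + (L x - U (S (U.adjFun (L x))))) = x
    rw [Adjointable.map_add, Adjointable.map_sub]
    simp only [Adjointable.adjoint_apply, hS, sub_self, add_zero]
  · exact (isDualTo_iff hU hcan).mpr ((hadj _).mpr hS)
  · obtain ⟨C', D', -, hD', hb'⟩ := isFrameOrOuterFrame_iff.mp hw.1
    obtain ⟨V, hV, -⟩ := hb'.exists_isAnalysisOperator hD'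
    have h := (hadj V).mp ((isDualTo_iff hU hV).mp hw)
    refine ⟨_, _, (hcan.hasSum x).tendsto_sum_nat, (hV.hasSum x).tendsto_sum_nat, ?_⟩
    rw [Adjointable.comp_apply]
    -- `V x - U S x` is orthogonal to `U S x`, because `U⋆ V = I = U⋆ U S`.
    have h0 : (HilbertModule.ip (U (S x)) (V x) : A) = HilbertModule.ip (U (S x)) (U (S x)) := by
      rw [U.ip_adj, U.ip_adj, h, hS]
    have h0' : (HilbertModule.ip (V x) (U (S x)) : A) = HilbertModule.ip (U (S x)) (U (S x)) := by
      rw [← star_ip, h0, star_ip]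
    have h1 : (0 : A) ≤ HilbertModule.ip (V x - U (S x)) (V x - U (S x)) := ip_self_nonneg _
    rw [ip_sub_left, ip_sub_right, ip_sub_right, h0, h0', sub_self, sub_zero] at h1
    exact sub_nonneg.mp h1
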